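/- **Setting.** Let $K\subset\mathbb R^p$ be compact. Let $\mathcal M(K)$ be the space of Radon measures on $K$, i.e. the topological dual of $\mathcal C(K)$ with the weak-$*$ topology, let $\langle\mu,g\rangle$ be the pairing, and let $\mathcal M_+(K)$ be the cone of nonnegative measures. Let $a_1,\dots,a_d\in\mathcal C(K)$, $a_i\ge 0$, let $(A\mu)_i=\langle\mu,a_i\rangle$ and $A^*\lambda=\sum_i\lambda_i a_i$. For $t\in[0,1]$ let $\mathcal W_t:\mathcal M(K)\to\mathcal M(K)$ be linear and weak-$*$ continuous, with adjoint $\mathcal W_t^*:\mathcal C(K)\to\mathcal C(K)$. Assume that $\mu\ge 0$ implies $\mathcal W_t\mu\ge 0$ for all $t$, that $t\mapsto\langle\mathcal W_t\mu,g\rangle$ is measurable for all $\mu\in\mathcal M_+(K)$, $g\in\mathcal C(K)$, and that $\int_0^1\|\mathcal W_t^*1\|_\infty\,dt<\infty$. **Statistical model.** For $\mu\in\mathcal M_+(K)$ let $m_\mu$ be the measure $[t_1,t_2]\times B\mapsto\int_{t_1}^{t_2}(\mathcal W_t\mu)(B)\,dt$ on $[0,1]\times K$. The numbers $a_i(x)$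 are relative detection probabilities: for a constant $c>0$ with $\sum_i a_i\le c$ on $K$ ($c=1$ if the $a_i$ are probabilities), emissions form a Poisson point process on $[0,1]\times K$ of intensity measure $c\,m_\mu$, and, given the emissions, each of them, if it is located at $(t,x)$, is independently detected at time $t$ by detector $i$ with probability $a_i(x)/c$, or is not detected, with probability $1-\sum_i a_i(x)/c$. The data $y$ are the numbers $n_i$ of detections and the (unordered) detection times $t^i_j\in[0,1]$, $1\le j\le n_i$, for each detector $i=1,\dots,d$. **Loss.** Let $f:=\int_0^1\mathcal W_t^*A^*\mathbf 1\,dt$, where $\mathbf 1=(1,\dots,1)$, and let $\Gamma$ be the family (with repetitions) of the $n=\sum_i n_i$ functions $\mathcal W_{t^i_j}^*a_i$, $1\le i\le d$, $1\le j\le n_i$. For $\mu\in\mathcal M_+(K)$ put $$\ell(\mu)=\ell_y(\mu):=\langle\mu,f\rangle-\sum_{\gamma\in\Gamma}\log\langle\mu,\gamma\rangle ,$$ with $\ell(\mu)=+\infty$ if $\mu\notin\operatorname{dom}(\ell)=\{\mu\in\mathcal M_+(K):\langle\mu,\gamma\rangle>0\ \ \forall\gamma\in\Gamma\}$. **Statement.**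 The integral that defines $f$ converges as a Bochner integral in $\mathcal C(K)$, and for all $\mu\in\mathcal M_+(K)$ the functions $\beta_i(t):=(A\mathcal W_t\mu)_i$ belong to $L^1(0,1)$. Put $$L(\mu;y):=\prod_{i=1}^d\Big(e^{-\int_0^1\beta_i(t)\,dt}\prod_{j=1}^{n_i}\beta_i(t^i_j)\Big).$$ 1. $L$ is a likelihood function of the model: for every $\mu\in\mathcal M_+(K)$ and every admissible $c$, $L(\mu;\cdot)$ is measurable, and it is the density of the law of the data with respect to the reference measure on list-mode data, which does not depend on $\mu$ and is the product over the $d$ detectors of the measures $\sum_{n\ge 0}\frac1{n!}\,dt_1\cdots dt_n$. Here data are identified with the point measures $\sum_j\delta_{t^i_j}$, $i=1,\dots,d$, i.e. both the law and the measure with this density are pushed forward to $d$-tuples of measures on $[0,1]$. 2. For all data $y$ and all $\mu\in\mathcal M_+(K)$, $-\log L(\mu;y)=\ell_y(\mu)$ in $[-\infty,+\infty]$, where $-\log 0=+\infty$. 3. Hence the maximum likelihood problem is $\min_{\mu\in\mathcal M_+(K)}\ell_y(\mu)$: for all data $y$, a measure $\mu^\star\in\mathcal M_+(K)$ maximises $L(\cdot\,;y)$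 over $\mathcal M_+(K)$ if and only if it minimises $\ell_y$ over $\mathcal M_+(K)$. -/

import Mathlib

open MeasureTheory ProbabilityTheory Set
open scoped unitInterval ENNReal NNReal

noncomputable section

namespace ListModePET

/-! ### Radon measures and operators on them -/

section Radon

variable {X : Type*} [TopologicalSpace X]

/-- The space `M(X)` of (signed) Radon measures on a compact space `X`: the topological dual of
`C(X)`, with its weak-star topology. The pairing of `μ` with `g` is `μ g`. -/
abbrev Radon (X : Type*) [TopologicalSpace X] : Type _ := WeakDual ℝ C(X, ℝ)

/-- `μ ≥ 0`, tested against nonnegative continuous functions. -/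
def IsNonneg (μ : Radon X) : Prop := ∀ g : C(X, ℝ), 0 ≤ g → 0 ≤ μ g

/-- The cone `M₊(X)` of nonnegative Radon measures. -/
abbrev PosRadon (X : Type*) [TopologicalSpace X] : Type _ := {μ : Radon X // IsNonneg μ}

theorem exists_adjoint (T : Radon X →L[ℝ] Radon X) (g : C(X, ℝ)) :
    ∃ h : C(X, ℝ), ∀ μ : Radon X, T μ g = μ h := by
  let ev : Radon X →L[ℝ] ℝ := WeakBilin.eval (topDualPairing ℝ C(X, ℝ)) g
  obtain ⟨h, hh⟩ :=
    LinearMap.dualEmbedding_surjective (topDualPairing ℝ C(X, ℝ)) (ev.comp T)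
  exact ⟨h, fun μ => (DFunLike.congr_fun hh μ).symm⟩

/-- The adjoint `T* : C(X) → C(X)` of a weak-star continuous operator `T` on `M(X)`,
characterised by `adjoint_spec`. -/
def adjoint (T : Radon X →L[ℝ] Radon X) (g : C(X, ℝ)) : C(X, ℝ) := (exists_adjoint T g).choose

theorem adjoint_spec (T : Radon X →L[ℝ] Radon X) (g : C(X, ℝ)) (μ : Radon X) :
    T μ g = μ (adjoint T g) := (exists_adjoint T g).choose_spec μ

variable [CompactSpace X] [T2Space X] [MeasurableSpace X] [BorelSpace X]

/-- A nonnegative Radon measure as a positive functional on compactly supported functions. -/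
def PosRadon.functional (μ : PosRadon X) : CompactlySupportedContinuousMap X ℝ →ₚ[ℝ] ℝ :=
  PositiveLinearMap.mk₀
    { toFun := fun g => μ.1 (g : C(X, ℝ))
      map_add' := fun g h => map_add μ.1 (g : C(X, ℝ)) (h : C(X, ℝ))
      map_smul' := fun c g => map_smul μ.1 c (g : C(X, ℝ)) }
    fun g hg => μ.2 (g : C(X, ℝ)) fun x => hg x

/-- The Borel measure that represents a nonnegative Radon measure (Riesz-Markov-Kakutani). -/
def PosRadon.borel (μ : PosRadon X) : Measure X := RealRMK.rieszMeasure μ.functional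

theorem PosRadon.integral_borel (μ : PosRadon X) (g : C(X, ℝ)) :
    ∫ x, g x ∂μ.borel = μ.1 g :=
  RealRMK.integral_rieszMeasure μ.functional
    (CompactlySupportedContinuousMap.continuousMapEquiv g)

end Radon

/-! ### Poisson point processes, thinning -/

section Processes

variable {Ω S : Type*} [MeasurableSpace Ω] [MeasurableSpace S]

/-- The Poisson distribution of mean `r ∈ [0, ∞]` on `[0, ∞]`. -/
def poissonENNReal (r : ℝ≥0∞) : Measure ℝ≥0∞ :=
  if r = ⊤ then Measure.dirac ⊤ else (poissonMeasure r.toNNReal).map fun n : ℕ => (n : ℝ≥0∞)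

/-- The random measure `η` is a Poisson point process of intensity measure `m`: numbers of points
in measurable sets are Poisson, and independent for disjoint sets. -/
structure IsPoissonProcess (P : Measure Ω) (η : Ω → Measure S) (m : Measure S) : Prop where
  measurable : Measurable η
  count_law : ∀ B : Set S, MeasurableSet B → P.map (fun ω => η ω B) = poissonENNReal (m B)
  count_indep : ∀ (n : ℕ) (B : Fin n → Set S), (∀ j, MeasurableSet (B j)) →
    Pairwise (fun j k => Disjoint (B j) (B k)) → iIndepFun (fun j ω => η ω (B j)) P

variable {X : Type*} [MeasurableSpace X] {d : ℕ}

/-- Probability that a point emitted at `x` ends up with the mark `e`, where `some i` means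
"detected in detector `i`", of probability `p i x`, and `none` means "not detected". -/
def markProb (p : Fin d → X → ℝ) : Option (Fin d) → X → ℝ
  | some i => p i
  | none => fun x => 1 - ∑ i, p i x

/-- An emission and detection experiment. There are `N` emissions, the `k`-th one at the time and
position `Z k`, and they form a Poisson point process of intensity measure `m` on time-space.
Given the emissions, each is independently detected in detector `i` with probability `p i x`,
where `x` is its position, or not detected at all; `D k` records the result for the `k`-th one.
The values of `Z k` and `D k` for `k ≥ N` play no role. -/
structure IsExperiment (P : Measure Ω) (m : Measure (I × X)) (p : Fin d → X → ℝ)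
    (N : Ω → ℕ) (Z : ℕ → Ω → I × X) (D : ℕ → Ω → Option (Fin d)) : Prop where
  measurable_num : Measurable N
  measurable_point : ∀ k, Measurable (Z k)
  measurableSet_mark : ∀ k e, MeasurableSet {ω | D k ω = e}
  emission : IsPoissonProcess P (fun ω => ∑ k ∈ Finset.range (N ω), Measure.dirac (Z k ω)) m
  detection : ∀ (n : ℕ) (e : Fin n → Option (Fin d)) (E : Set (Fin n → I × X)), MeasurableSet E →
    P {ω | (N ω = n ∧ (fun k : Fin n => Z k ω) ∈ E) ∧ ∀ k : Fin n, D k ω = e k} =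
      ∫⁻ ω in {ω | N ω = n ∧ (fun k : Fin n => Z k ω) ∈ E},
        ∏ k : Fin n, ENNReal.ofReal (markProb p (e k) (Z k ω).2) ∂P

/-- The observation: for every detector, the point measure on `[0, 1]` of the times at which it
detects (detection takes place at the time of emission). -/
def observation (N : Ω → ℕ) (Z : ℕ → Ω → I × X) (D : ℕ → Ω → Option (Fin d)) (ω : Ω) :
    Fin d → Measure I :=
  fun i => ∑ k ∈ (Finset.range (N ω)).filter (fun k => D k ω = some i), Measure.dirac (Z k ω).1

end Processes

/-! ### List-mode data -/

/-- List-mode data for `d` detectors: for each detector `i`, a number `n_i = (y i).1` of detections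
and detection times `t_j^i = (y i).2 j` in `[0, 1]`. -/
abbrev Data (d : ℕ) : Type := Fin d → (n : ℕ) × (Fin n → I)

/-- List-mode data as point measures on `[0, 1]`; this forgets the order of the times. -/
def Data.toPoints {d : ℕ} (y : Data d) : Fin d → Measure I :=
  fun i => ∑ j, Measure.dirac ((y i).2 j)

/-- The measure `∑ₙ (1 / n!) dt₁ ⋯ dtₙ` on finite lists of times. -/
def refList : Measure ((n : ℕ) × (Fin n → I)) :=
  Measure.sum fun n : ℕ =>
    ((n.factorial : ℝ≥0∞)⁻¹) • (volume : Measure (Fin n → I)).map (Sigma.mk n)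

/-- The reference measure on list-mode data with respect to which likelihoods are densities; the
factor `1 / n!` is there because the times of a detector carry no order. -/
def refData (d : ℕ) : Measure (Data d) := Measure.pi fun _ => refList

/-! ### The tomography model -/

section Model

variable {X : Type*} [TopologicalSpace X] {d : ℕ}

/-- The operator `A : M(X) → ℝ^d`, `(A μ)_i = ⟨μ, a_i⟩`. -/
def petOp (a : Fin d → C(X, ℝ)) (μ : Radon X) : Fin d → ℝ := fun i => μ (a i)

/-- Its adjoint `A* : ℝ^d → C(X)`, `A* v = ∑ v_i a_i`. -/
def petAdjoint (a : Fin d → C(X, ℝ)) (v : Fin d → ℝ) : C(X, ℝ) := ∑ i, v i • a i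

/-- `μ ≥ 0` implies `W_t μ ≥ 0`. -/
def PreservesNonneg (W : I → Radon X →L[ℝ] Radon X) : Prop :=
  ∀ t (μ : Radon X), IsNonneg μ → IsNonneg (W t μ)

/-- The activity `W_t μ` at time `t`, as an element of `M₊(X)`. -/
def activity (W : I → Radon X →L[ℝ] Radon X) (hW : PreservesNonneg W) (μ : PosRadon X) (t : I) :
    PosRadon X := ⟨W t μ.1, hW t μ.1 μ.2⟩

/-- The detection intensity `β_i(t) = (A W_t μ)_i`. -/
def detIntensity (a : Fin d → C(X, ℝ)) (W : I → Radon X →L[ℝ] Radon X) (μ : PosRadon X)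
    (i : Fin d) (t : I) : ℝ := petOp a (W t μ.1) i

/-- The likelihood of `μ` given the data `y`: the product over the detectors of
`exp (-∫ β_i) ∏_j β_i(t_j^i)`. -/
def likelihood (a : Fin d → C(X, ℝ)) (W : I → Radon X →L[ℝ] Radon X) (μ : PosRadon X)
    (y : Data d) : ℝ≥0∞ :=
  ENNReal.ofReal (∏ i, (Real.exp (-∫ t : I, detIntensity a W μ i t) *
    ∏ j, detIntensity a W μ i ((y i).2 j)))

/-- The family `Γ` of the functions `W_{t_j^i}* a_i`, one for each detection. -/
def Gam (a : Fin d → C(X, ℝ)) (W : I → Radon X →L[ℝ] Radon X) (y : Data d)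
    (e : (i : Fin d) × Fin (y i).1) : C(X, ℝ) := adjoint (W ((y e.1).2 e.2)) (a e.1)

variable [CompactSpace X]

/-- `f = ∫₀¹ W_t* A* 1 dt`, a Bochner integral in `C(X)`. -/
def backproj (a : Fin d → C(X, ℝ)) (W : I → Radon X →L[ℝ] Radon X) : C(X, ℝ) :=
  ∫ t : I, adjoint (W t) (petAdjoint a fun _ => 1)

open scoped Classical in
/-- The loss `ℓ(μ) = ⟨μ, f⟩ - ∑_{γ ∈ Γ} log ⟨μ, γ⟩`, with value `+∞` unless all `⟨μ, γ⟩` are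
positive. -/
def loss (a : Fin d → C(X, ℝ)) (W : I → Radon X →L[ℝ] Radon X) (y : Data d) (μ : PosRadon X) :
    EReal :=
  if ∀ e, 0 < μ.1 (Gam a W y e) then
    ((μ.1 (backproj a W) - ∑ e, Real.log (μ.1 (Gam a W y e)) : ℝ) : EReal)
  else ⊤

variable [T2Space X] [MeasurableSpace X] [BorelSpace X]

/-- The measure `[t₁, t₂] × B ↦ ∫_{t₁}^{t₂} (W_t μ)(B) dt` on `[0, 1] × X`. -/
def timeSpaceMeasure (W : I → Radon X →L[ℝ] Radon X) (hW : PreservesNonneg W) (μ : PosRadon X) :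
    Measure (I × X) :=
  (volume : Measure I).bind fun t => (activity W hW μ t).borel.map (Prod.mk t)

end Model

end ListModePET

end

open ListModePET

/-! The law of a finite family of random measures is determined by its Laplace functional `E ∏ᵢ
exp(-∫ uᵢ dνᵢ)`, `uᵢ ≥ 0` measurable (`ext_of_laplaceFunctional`), so the density claim reduces to
computing this functional on both sides.

Experiment: the integrand is a product over emissions of a weight depending on mark and position.
Averaging over the marks (`IsExperiment.lintegral_prod_mark`) leaves `E ∏ₖ h(Zₖ)` with `h ≤ 1`,
which the Poisson generating functional (`IsPoissonProcess.lintegral_prod`) evaluates as `exp(∫ (h -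
1) d(c m_μ))`. Undetected emissions cancel, the factor `c` cancels against `aᵢ / c`, and `exp(∑ᵢ ∫
(e^{-uᵢ} - 1) βᵢ dt)` remains.

Density: by Fubini over detectors and the exponential series, `∑ₙ (1/n!) (∫ f)ⁿ = exp(∫ f)` with `f
= e^{-uᵢ} βᵢ`, times `exp(-∫ βᵢ)`, gives the same value (`lintegral_likelihood_mul_prod_expNeg`).

The loss identity is a logarithm plus `⟨μ, f⟩ = ∑ᵢ ∫ βᵢ`, as `μ` commutes with the Bochner integral.
The equivalence of the two optimisation problems follows because `-log` reverses order on `[0, ∞]`.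
-/

namespace ListModePET

/-! ### Positive functionals, adjoints and Bochner integrability. -/

section RadonFacts

variable {X : Type*} [TopologicalSpace X]

/-- The Dirac measure at `x` as a Radon measure. -/
noncomputable def evalRadon [CompactSpace X] (x : X) : Radon X :=
  StrongDual.toWeakDual (ContinuousMap.evalCLM ℝ x)

theorem isNonneg_evalRadon [CompactSpace X] (x : X) : IsNonneg (evalRadon x) := fun _ hg => hg x

theorem IsNonneg.mono {μ : Radon X} (hμ : IsNonneg μ) {g h : C(X, ℝ)} (hgh : g ≤ h) :
    μ g ≤ μ h := by
  have := hμ (h - g) (sub_nonneg.2 hgh)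
  rw [map_sub] at this
  linarith

theorem IsNonneg.abs_apply_le [CompactSpace X] {μ : Radon X} (hμ : IsNonneg μ) (g : C(X, ℝ)) :
    |μ g| ≤ ‖g‖ * μ 1 := by
  have h1 : ‖g‖ * μ 1 = μ (‖g‖ • (1 : C(X, ℝ))) := by rw [map_smul, smul_eq_mul]
  rw [h1, abs_le, ← map_neg]
  constructor <;> refine hμ.mono fun x => ?_
  · simpa using (abs_le.1 (g.norm_coe_le_norm x)).1
  · simpa using (abs_le.1 (g.norm_coe_le_norm x)).2

variable [CompactSpace X]

theorem adjoint_apply (T : Radon X →L[ℝ] Radon X) (g : C(X, ℝ)) (x : X) :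
    adjoint T g x = T (evalRadon x) g := (adjoint_spec T g (evalRadon x)).symm

/-- Tested on Dirac measures, positivity makes the constant `1` control every `g`; this is why
integrability of `‖W_t* 1‖` suffices for the Bochner integrals. -/
theorem norm_adjoint_le {T : Radon X →L[ℝ] Radon X} (hT : ∀ μ, IsNonneg μ → IsNonneg (T μ))
    (g : C(X, ℝ)) : ‖adjoint T g‖ ≤ ‖g‖ * ‖adjoint T 1‖ := by
  rw [ContinuousMap.norm_le _ (by positivity)]
  intro x
  rw [adjoint_apply, Real.norm_eq_abs]
  refine ((hT _ (isNonneg_evalRadon x)).abs_apply_le g).trans ?_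
  gcongr
  rw [← adjoint_apply]
  exact (le_abs_self _).trans ((adjoint T 1).norm_coe_le_norm x)

/-- Restriction to a countable dense set is a continuous injection of the Polish space `C(X, ℝ)`
into a countable power of `ℝ`, hence a measurable embedding. Pointwise measurability is thus Borel
measurability, and separability makes it strong. -/
theorem stronglyMeasurable_continuousMap [T2Space X] [SecondCountableTopology X] {T : Type*}
    [MeasurableSpace T] {f : T → C(X, ℝ)} (hf : ∀ x, Measurable fun t => f t x) :
    StronglyMeasurable f := by
  borelize C(X, ℝ)
  obtain ⟨s, hs, hd⟩ := TopologicalSpace.exists_countable_dense X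
  have : Countable s := hs
  let ev : C(X, ℝ) → s → ℝ := fun g x => g x
  have hev : Continuous ev := by fun_prop
  have hinj : Function.Injective ev := fun g h hgh =>
    DFunLike.coe_injective <| g.continuous.ext_on hd h.continuous
      fun x hx => congr_fun hgh ⟨x, hx⟩
  have : Measurable f := (hev.measurableEmbedding hinj).measurable_comp_iff.1 <|
    measurable_pi_lambda _ fun x => hf x
  exact this.stronglyMeasurable

variable [T2Space X] [SecondCountableTopology X]

theorem integrable_adjoint {W : I → Radon X →L[ℝ] Radon X} (hW : PreservesNonneg W)
    (hmeas : ∀ (μ : PosRadon X) (g : C(X, ℝ)), Measurable fun t : I => W t μ.1 g)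
    (hint : ∫⁻ t : I, ‖adjoint (W t) 1‖ₑ < ⊤) (g : C(X, ℝ)) :
    Integrable fun t : I => adjoint (W t) g := by
  have hm : ∀ g, StronglyMeasurable fun t : I => adjoint (W t) g := fun g =>
    stronglyMeasurable_continuousMap fun x => by
      simp_rw [adjoint_apply]
      exact hmeas ⟨_, isNonneg_evalRadon x⟩ g
  have h1 : Integrable fun t : I => adjoint (W t) 1 := ⟨(hm 1).aestronglyMeasurable, hint⟩
  refine (h1.norm.const_mul ‖g‖).mono' (hm g).aestronglyMeasurable (ae_of_all _ fun t => ?_)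
  exact norm_adjoint_le (hW t) g

theorem integrable_detIntensity {d : ℕ} (a : Fin d → C(X, ℝ)) {W : I → Radon X →L[ℝ] Radon X}
    (hW : PreservesNonneg W)
    (hmeas : ∀ (μ : PosRadon X) (g : C(X, ℝ)), Measurable fun t : I => W t μ.1 g)
    (hint : ∫⁻ t : I, ‖adjoint (W t) 1‖ₑ < ⊤) (μ : PosRadon X) (i : Fin d) :
    Integrable (detIntensity a W μ i) := by
  have := (WeakDual.toStrongDual μ.1).integrable_comp (integrable_adjoint hW hmeas hint (a i))
  refine this.congr (ae_of_all _ fun t => ?_)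
  exact (adjoint_spec (W t) (a i) μ.1).symm

theorem apply_backproj {d : ℕ} (a : Fin d → C(X, ℝ)) {W : I → Radon X →L[ℝ] Radon X}
    (hW : PreservesNonneg W)
    (hmeas : ∀ (μ : PosRadon X) (g : C(X, ℝ)), Measurable fun t : I => W t μ.1 g)
    (hint : ∫⁻ t : I, ‖adjoint (W t) 1‖ₑ < ⊤) (μ : PosRadon X) :
    μ.1 (backproj a W) = ∑ i, ∫ t : I, detIntensity a W μ i t := by
  have := (WeakDual.toStrongDual μ.1).integral_comp_comm
    (integrable_adjoint hW hmeas hint (petAdjoint a fun _ => 1))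
  rw [← integral_finsetSum _ fun i _ => integrable_detIntensity a hW hmeas hint μ i]
  refine this.symm.trans (integral_congr_ae (ae_of_all _ fun t => ?_))
  refine (adjoint_spec (W t) _ μ.1).symm.trans ?_
  simp [petAdjoint, detIntensity, petOp]

end RadonFacts

/-! ### The negative log-likelihood and measurability of the likelihood. -/

section Loss

variable {X : Type*} [TopologicalSpace X] {d : ℕ}

theorem detIntensity_nonneg {a : Fin d → C(X, ℝ)} (ha : ∀ i, 0 ≤ a i)
    {W : I → Radon X →L[ℝ] Radon X} (hW : PreservesNonneg W) (μ : PosRadon X) (i : Fin d) (t : I) :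
    0 ≤ detIntensity a W μ i t := hW t μ.1 μ.2 _ (ha i)

theorem neg_log_likelihood [CompactSpace X] [T2Space X] [SecondCountableTopology X]
    {a : Fin d → C(X, ℝ)} (ha : ∀ i, 0 ≤ a i)
    {W : I → Radon X →L[ℝ] Radon X} (hW : PreservesNonneg W)
    (hmeas : ∀ (μ : PosRadon X) (g : C(X, ℝ)), Measurable fun t : I => W t μ.1 g)
    (hint : ∫⁻ t : I, ‖adjoint (W t) 1‖ₑ < ⊤) (y : Data d) (μ : PosRadon X) :
    -(likelihood a W μ y).log = loss a W y μ := by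
  have hG : ∀ e, μ.1 (Gam a W y e) = detIntensity a W μ e.1 ((y e.1).2 e.2) := fun e =>
    (adjoint_spec _ _ _).symm
  simp only [loss, hG, likelihood]
  split_ifs with h
  · have hpos : ∀ i j, 0 < detIntensity a W μ i ((y i).2 j) := fun i j => h ⟨i, j⟩
    rw [ENNReal.log_ofReal_of_pos (Finset.prod_pos fun i _ => mul_pos (Real.exp_pos _) <|
      Finset.prod_pos fun j _ => hpos i j), ← EReal.coe_neg, EReal.coe_eq_coe_iff,
      apply_backproj a hW hmeas hint, Real.log_prod fun i _ => (mul_pos (Real.exp_pos _) <|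
      Finset.prod_pos fun j _ => hpos i j).ne', Fintype.sum_sigma, ← Finset.sum_sub_distrib,
      ← Finset.sum_neg_distrib]
    refine Finset.sum_congr rfl fun i _ => ?_
    rw [Real.log_mul (Real.exp_pos _).ne' (Finset.prod_pos fun j _ => hpos i j).ne', Real.log_exp,
      Real.log_prod fun j _ => (hpos i j).ne']
    ring
  -- A factor that is not positive is exactly `0` by positivity of `a i` and `W t`, so two negative
  -- factors cannot compensate; the likelihood vanishes and both sides are `⊤`.
  · push Not at h
    obtain ⟨⟨i, j⟩, hij⟩ := h
    have h0 : detIntensity a W μ i ((y i).2 j) = 0 :=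
      le_antisymm hij (detIntensity_nonneg ha hW μ i _)
    have h1 : ∏ j, detIntensity a W μ i ((y i).2 j) = 0 :=
      Finset.prod_eq_zero (Finset.mem_univ j) h0
    rw [Finset.prod_eq_zero (Finset.mem_univ i) (by rw [h1, mul_zero])]
    simp

theorem measurable_detIntensity (a : Fin d → C(X, ℝ)) {W : I → Radon X →L[ℝ] Radon X}
    (hmeas : ∀ (μ : PosRadon X) (g : C(X, ℝ)), Measurable fun t : I => W t μ.1 g)
    (μ : PosRadon X) (i : Fin d) : Measurable (detIntensity a W μ i) := hmeas μ (a i)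

theorem measurable_sigma_iff {ι : Type*} {S : ι → Type*} [∀ i, MeasurableSpace (S i)] {β : Type*}
    [MeasurableSpace β] {f : Sigma S → β} :
    Measurable f ↔ ∀ i, Measurable fun s : S i => f ⟨i, s⟩ := by
  refine ⟨fun hf i => hf.comp fun s hs => MeasurableSpace.measurableSet_iInf.1 hs i,
    fun hf s hs => MeasurableSpace.measurableSet_iInf.2 fun i => hf i hs⟩

theorem measurable_likelihood (a : Fin d → C(X, ℝ)) {W : I → Radon X →L[ℝ] Radon X}
    (hmeas : ∀ (μ : PosRadon X) (g : C(X, ℝ)), Measurable fun t : I => W t μ.1 g)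
    (μ : PosRadon X) : Measurable (likelihood a W μ) := by
  refine ENNReal.measurable_ofReal.comp (Finset.measurable_prod _ fun i _ => ?_)
  have h : Measurable fun z : (n : ℕ) × (Fin n → I) =>
      Real.exp (-∫ t : I, detIntensity a W μ i t) * ∏ j, detIntensity a W μ i (z.2 j) := by
    refine measurable_sigma_iff.2 fun n => Measurable.const_mul ?_ _
    change Measurable fun s : Fin n → I => ∏ j, detIntensity a W μ i (s j)
    exact Finset.measurable_prod _ fun j _ =>
      (measurable_detIntensity a hmeas μ i).comp (measurable_pi_apply j)
  exact h.comp (measurable_pi_apply (X := fun _ : Fin d => (n : ℕ) × (Fin n → I)) i)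

end Loss

/-! ### Integration against the time-space measure. -/

section Intensity

/-- On a rectangle `s ×ˢ r` the measure is `1_s(t) κ_t(r)`, and rectangles form a generating
π-system. This measurability lets integrals against the `bind` in `timeSpaceMeasure` be computed as
iterated integrals. -/
theorem measurable_map_prodMk {T X : Type*} [MeasurableSpace T] [MeasurableSpace X] {κ : T → Measure X}
    [∀ t, IsFiniteMeasure (κ t)] (hκ : Measurable κ) :
    Measurable fun t => (κ t).map (Prod.mk t) := by
  have h : ∀ s : Set T, MeasurableSet s → ∀ r : Set X, MeasurableSet r →
      Measurable fun t => (κ t).map (Prod.mk t) (s ×ˢ r) := by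
    intro s hs r hr
    have : ∀ t, (κ t).map (Prod.mk t) (s ×ˢ r) = s.indicator (fun t => κ t r) t := fun t => by
      rw [Measure.map_apply measurable_prodMk_left (hs.prod hr)]
      by_cases ht : t ∈ s <;> simp [ht]
    simp_rw [this]
    exact ((Measure.measurable_coe hr).comp hκ).indicator hs
  refine Measurable.measure_of_isPiSystem generateFrom_prod.symm isPiSystem_prod ?_ ?_
  · rintro _ ⟨s, hs, r, hr, rfl⟩
    exact h s hs r hr
  · rw [← univ_prod_univ]
    exact h _ .univ _ .univ

variable {X : Type*} [TopologicalSpace X] [CompactSpace X] [T2Space X] [MeasurableSpace X]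
  [BorelSpace X]

instance (μ : PosRadon X) : IsFiniteMeasure μ.borel :=
  inferInstanceAs (IsFiniteMeasure (RealRMK.rieszMeasure _))

theorem PosRadon.lintegral_borel (μ : PosRadon X) {g : C(X, ℝ)} (hg : 0 ≤ g) :
    ∫⁻ x, ENNReal.ofReal (g x) ∂μ.borel = ENNReal.ofReal (μ.1 g) := by
  rw [← μ.integral_borel, ofReal_integral_eq_lintegral_ofReal
    (g.continuous.integrable_of_hasCompactSupport (HasCompactSupport.of_compactSpace _))
    (ae_of_all _ fun x => hg x)]

variable [HasOuterApproxClosed X]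

/-- Indicators of closed sets are limits of continuous functions, and closed sets form a π-system
generating the Borel sets. -/
theorem measurable_borel {T : Type*} [MeasurableSpace T] {μ : T → PosRadon X}
    (hμ : ∀ g : C(X, ℝ), Measurable fun t => (μ t).1 g) : Measurable fun t => (μ t).borel := by
  have hc : ∀ F : Set X, IsClosed F → Measurable fun t => (μ t).borel F := by
    intro F hF
    refine measurable_of_tendsto_metrizable' (f := fun (n : ℕ) t =>
      ∫⁻ x, hF.apprSeq n x ∂(μ t).borel) Filter.atTop (fun n => ?_)
      (tendsto_pi_nhds.2 fun t => HasOuterApproxClosed.tendsto_lintegral_apprSeq hF _)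
    let g : C(X, ℝ) := ⟨fun x => (hF.apprSeq n x : ℝ), by fun_prop⟩
    have : ∀ t, ∫⁻ x, hF.apprSeq n x ∂(μ t).borel = ENNReal.ofReal ((μ t).1 g) := fun t => by
      rw [← (μ t).lintegral_borel (g := g) fun x => NNReal.coe_nonneg _]
      simp [g]
    simp_rw [this]
    exact (hμ g).ennreal_ofReal
  refine Measurable.measure_of_isPiSystem
    (BorelSpace.measurable_eq.trans borel_eq_generateFrom_isClosed) isPiSystem_isClosed hc
    (hc _ isClosed_univ)

variable {W : I → Radon X →L[ℝ] Radon X} (hW : PreservesNonneg W)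

theorem lintegral_timeSpaceMeasure
    (hmeas : ∀ (μ : PosRadon X) (g : C(X, ℝ)), Measurable fun t : I => W t μ.1 g)
    (μ : PosRadon X) {F : I × X → ℝ≥0∞} (hF : Measurable F) :
    ∫⁻ z, F z ∂timeSpaceMeasure W hW μ = ∫⁻ t, ∫⁻ x, F (t, x) ∂(activity W hW μ t).borel := by
  have hm := measurable_borel (μ := activity W hW μ) fun g => hmeas μ g
  rw [timeSpaceMeasure, Measure.lintegral_bind (measurable_map_prodMk hm).aemeasurable
    hF.aemeasurable]
  exact lintegral_congr fun t => lintegral_map hF measurable_prodMk_left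

theorem lintegral_timeSpaceMeasure_mul
    (hmeas : ∀ (μ : PosRadon X) (g : C(X, ℝ)), Measurable fun t : I => W t μ.1 g)
    (μ : PosRadon X) {v : I → ℝ≥0∞} (hv : Measurable v) {g : C(X, ℝ)} (hg : 0 ≤ g) :
    ∫⁻ z, v z.1 * ENNReal.ofReal (g z.2) ∂timeSpaceMeasure W hW μ =
      ∫⁻ t, v t * ENNReal.ofReal (W t μ.1 g) := by
  have hgm : Measurable fun x => ENNReal.ofReal (g x) := g.continuous.measurable.ennreal_ofReal
  have hm : Measurable fun z : I × X => v z.1 * ENNReal.ofReal (g z.2) :=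
    (hv.comp measurable_fst).mul (hgm.comp measurable_snd)
  rw [lintegral_timeSpaceMeasure hW hmeas μ hm]
  refine lintegral_congr fun t => ?_
  change ∫⁻ x, v t * ENNReal.ofReal (g x) ∂(activity W hW μ t).borel = _
  rw [lintegral_const_mul _ hgm, PosRadon.lintegral_borel _ hg]
  rfl

theorem isFiniteMeasure_timeSpaceMeasure [SecondCountableTopology X]
    (hmeas : ∀ (μ : PosRadon X) (g : C(X, ℝ)), Measurable fun t : I => W t μ.1 g)
    (hint : ∫⁻ t : I, ‖adjoint (W t) 1‖ₑ < ⊤) (μ : PosRadon X) :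
    IsFiniteMeasure (timeSpaceMeasure W hW μ) := by
  constructor
  have h := lintegral_timeSpaceMeasure_mul hW hmeas μ (v := 1) measurable_one (g := 1)
    (fun _ => zero_le_one)
  simp only [Pi.one_apply, ContinuousMap.one_apply, ENNReal.ofReal_one, mul_one, lintegral_one,
    one_mul] at h
  rw [h]
  -- The total mass is `∫ ⟨W_t μ, 1⟩ dt`, the integrated intensity of one fictitious detector with
  -- `a = 1`.
  exact (integrable_detIntensity (d := 1) (fun _ => 1) hW hmeas hint μ 0).lintegral_lt_top

end Intensity

/-! ### Laplace transforms and functionals determine laws. -/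

section Laplace

/-- The function `x ↦ exp (-x)` on `[0, ∞]`. -/
noncomputable def expNeg (x : ℝ≥0∞) : ℝ≥0∞ := EReal.exp (-(x : EReal))

theorem expNeg_zero : expNeg 0 = 1 := by simp [expNeg]

theorem expNeg_add (x y : ℝ≥0∞) : expNeg (x + y) = expNeg x * expNeg y := by
  rw [expNeg, expNeg, expNeg, ← EReal.exp_add, EReal.coe_ennreal_add, EReal.neg_add,
    sub_eq_add_neg] <;> simp

theorem expNeg_sum {ι : Type*} (s : Finset ι) (x : ι → ℝ≥0∞) :
    expNeg (∑ i ∈ s, x i) = ∏ i ∈ s, expNeg (x i) := by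
  induction s using Finset.cons_induction with
  | empty => simp [expNeg_zero]
  | cons i s hi ih => rw [Finset.sum_cons, Finset.prod_cons, expNeg_add, ih]

theorem expNeg_nat_mul (n : ℕ) (x : ℝ≥0∞) : expNeg (n * x) = expNeg x ^ n := by
  rw [← nsmul_eq_mul, ← Finset.card_range n, ← Finset.sum_const, expNeg_sum, Finset.prod_const]

theorem expNeg_le_one (x : ℝ≥0∞) : expNeg x ≤ 1 := by
  rw [expNeg, EReal.exp_le_one_iff, EReal.neg_le, neg_zero]
  exact EReal.coe_ennreal_nonneg x

theorem expNeg_injective : Function.Injective expNeg := fun x y h => by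
  simpa [expNeg] using EReal.exp_strictMono.injective h

theorem continuous_expNeg : Continuous expNeg :=
  ENNReal.continuous_exp.comp (continuous_neg.comp continuous_coe_ennreal_ereal)

theorem measurable_expNeg : Measurable expNeg := continuous_expNeg.measurable

/-- The function `x ↦ exp (-x j)` on `[0, ∞]^ι`, bounded and continuous. -/
noncomputable def coordExpNeg {ι : Type*} (j : ι) :
    BoundedContinuousFunction (ι → ℝ≥0∞) ℝ :=
  .ofNormedAddCommGroup (fun x => (expNeg (x j)).toReal)
    (continuous_iff_continuousAt.2 fun x => ContinuousAt.comp (g := ENNReal.toReal)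
      (ENNReal.continuousAt_toReal ((expNeg_le_one _).trans_lt ENNReal.one_lt_top).ne)
      (continuous_expNeg.comp (continuous_apply j)).continuousAt) 1
    fun x => by
      rw [Real.norm_of_nonneg ENNReal.toReal_nonneg]
      exact ENNReal.toReal_mono ENNReal.one_ne_top (expNeg_le_one _)

/-- A finite measure on `[0, ∞]^ι` is determined by its Laplace transform at integer points. -/
theorem ext_of_lintegral_prod_expNeg_pow {ι : Type*} [Fintype ι] {P Q : Measure (ι → ℝ≥0∞)}
    [IsFiniteMeasure P] [IsFiniteMeasure Q]
    (h : ∀ k : ι → ℕ, ∫⁻ x, ∏ j, expNeg (x j) ^ k j ∂P = ∫⁻ x, ∏ j, expNeg (x j) ^ k j ∂Q) :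
    P = Q := by
  -- A point-separating algebra of bounded continuous functions determines a finite measure on a
  -- Polish space; the functions `exp(-xⱼ)` separate points even at `∞`.
  let A : StarSubalgebra ℝ (BoundedContinuousFunction (ι → ℝ≥0∞) ℝ) :=
    { Algebra.adjoin ℝ (range coordExpNeg) with
      star_mem' := fun {f} hf => by
        have : star f = f := by ext; simp
        rwa [this] }
  have hA : ∀ g, g ∈ A ↔ g ∈ Algebra.adjoin ℝ (range (coordExpNeg (ι := ι))) := fun _ => Iff.rfl
  refine ext_of_forall_mem_subalgebra_integral_eq_of_polish (𝕜 := ℝ) (A := A) ?_ ?_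
  · intro x y hxy
    obtain ⟨j, hj⟩ := Function.ne_iff.1 hxy
    refine ⟨coordExpNeg j, ⟨(coordExpNeg j).toContinuousMap, ⟨coordExpNeg j, ?_, rfl⟩, rfl⟩, ?_⟩
    · exact (hA _).2 (Algebra.subset_adjoin ⟨j, rfl⟩)
    · intro he
      have he : (expNeg (x j)).toReal = (expNeg (y j)).toReal := he
      refine hj (expNeg_injective ((ENNReal.toReal_eq_toReal_iff' ?_ ?_).1 he)) <;>
        exact ((expNeg_le_one _).trans_lt ENNReal.one_lt_top).ne
  · intro g hg
    rw [hA, ← Subalgebra.mem_toSubmodule, Algebra.adjoin_eq_span] at hg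
    -- The algebra is spanned by the monomials `∏ⱼ exp(-kⱼ xⱼ)`, on which the integrals agree by
    -- assumption.
    induction hg using Submodule.span_induction with
    | mem g hg =>
      have : ∃ k : ι → ℕ, g = ∏ j, coordExpNeg j ^ k j := by
        classical
        induction hg using Submonoid.closure_induction with
        | mem g hg =>
          obtain ⟨j, rfl⟩ := hg
          exact ⟨Pi.single j 1, by simp [Pi.single_apply, Finset.prod_ite_eq']⟩
        | one => exact ⟨0, by simp⟩
        | mul f g _ _ hf hg =>
          obtain ⟨k, rfl⟩ := hf
          obtain ⟨l, rfl⟩ := hg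
          exact ⟨k + l, by simp [pow_add, Finset.prod_mul_distrib]⟩
      obtain ⟨k, rfl⟩ := this
      have hk : ∀ x : ι → ℝ≥0∞, (∏ j, coordExpNeg j ^ k j :
          BoundedContinuousFunction (ι → ℝ≥0∞) ℝ) x = (∏ j, expNeg (x j) ^ k j).toReal := by
        intro x
        simp [coordExpNeg, BoundedContinuousFunction.coe_prod, ENNReal.toReal_prod,
          ENNReal.toReal_pow]
      have hm : Measurable fun x : ι → ℝ≥0∞ => ∏ j, expNeg (x j) ^ k j :=
        Finset.measurable_prod _ fun j _ =>
          (measurable_expNeg.comp (measurable_pi_apply j)).pow_const _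
      have hfin : ∀ x : ι → ℝ≥0∞, ∏ j, expNeg (x j) ^ k j < ⊤ := fun x =>
        (Finset.prod_le_one' fun j _ => pow_le_one' (expNeg_le_one _) _).trans_lt
          ENNReal.one_lt_top
      simp_rw [hk]
      rw [integral_toReal hm.aemeasurable (ae_of_all _ hfin),
        integral_toReal hm.aemeasurable (ae_of_all _ hfin), h k]
    | zero => simp
    | add f g _ _ hf hg =>
      simp only [BoundedContinuousFunction.coe_add, Pi.add_apply]
      rw [integral_add (f.integrable P) (g.integrable P),
        integral_add (f.integrable Q) (g.integrable Q), hf, hg]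
    | smul c g _ hg =>
      simp only [BoundedContinuousFunction.coe_smul, integral_smul, hg]

/-- The law of a finite family of random measures is determined by its Laplace functional. -/
theorem ext_of_laplaceFunctional {ι S : Type*} [Fintype ι] [MeasurableSpace S]
    {P Q : Measure (ι → Measure S)} [IsFiniteMeasure P] [IsFiniteMeasure Q]
    (h : ∀ u : ι → S → ℝ≥0∞, (∀ i, Measurable (u i)) →
      ∫⁻ ν, ∏ i, expNeg (∫⁻ s, u i s ∂ν i) ∂P = ∫⁻ ν, ∏ i, expNeg (∫⁻ s, u i s ∂ν i) ∂Q) :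
    P = Q := by
  classical
  let ev : (ι → Measure S) → (ι × {B : Set S // MeasurableSet B}) → ℝ≥0∞ := fun ν j => ν j.1 j.2.1
  have hev : Measurable ev := measurable_pi_lambda _ fun j =>
    (Measure.measurable_coe j.2.2).comp (measurable_pi_apply (X := fun _ : ι => Measure S) j.1)
  have hmap : P.map ev = Q.map ev := by
    -- A finite measure on a product, even an uncountable one, is determined by its
    -- finite-dimensional marginals.
    refine IsProjectiveLimit.unique (P := fun J => (P.map ev).map J.restrict) (fun J => rfl)
      fun J => ?_
    rw [Measure.map_map J.measurable_restrict hev]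
    change Q.map (J.restrict ∘ ev) = (P.map ev).map J.restrict
    rw [Measure.map_map J.measurable_restrict hev]
    symm
    refine ext_of_lintegral_prod_expNeg_pow fun k => ?_
    have hm : Measurable fun x : J → ℝ≥0∞ => ∏ j, expNeg (x j) ^ k j :=
      Finset.measurable_prod _ fun j _ =>
        (measurable_expNeg.comp (measurable_pi_apply j)).pow_const _
    rw [lintegral_map hm (J.measurable_restrict.comp hev),
      lintegral_map hm (J.measurable_restrict.comp hev)]
    -- With `uᵢ = ∑ kⱼ 1_{Bⱼ}` over the pairs `j ∈ J` whose first component is `i`, the Laplace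
    -- functional at `u` is the Laplace transform of the marginal at `k`.
    let u : ι → S → ℝ≥0∞ := fun i s =>
      ∑ j : J with j.1.1 = i, k j * (j.1.2.1.indicator (fun _ => 1) s)
    have hu : ∀ i, Measurable (u i) := fun i => Finset.measurable_sum _ fun j _ =>
      (measurable_const.indicator j.1.2.2).const_mul _
    have key : ∀ ν : ι → Measure S, ∏ j, expNeg ((J.restrict ∘ ev) ν j) ^ k j =
        ∏ i, expNeg (∫⁻ s, u i s ∂ν i) := by
      intro ν
      have : ∀ i, ∫⁻ s, u i s ∂ν i = ∑ j : J with j.1.1 = i, k j * ν j.1.1 j.1.2.1 := by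
        intro i
        rw [lintegral_finsetSum _ fun j _ => (measurable_const.indicator j.1.2.2).const_mul _]
        refine Finset.sum_congr rfl fun j hj => ?_
        rw [lintegral_const_mul _ (measurable_const.indicator j.1.2.2),
          lintegral_indicator_const j.1.2.2, one_mul, (Finset.mem_filter.1 hj).2]
      simp_rw [this, expNeg_sum, expNeg_nat_mul]
      rw [← Finset.prod_fiberwise (s := Finset.univ) (g := fun j : J => j.1.1)]
      rfl
    simp_rw [key]
    exact h u hu
  -- The evaluations generate the σ-algebra, so every measurable set is a preimage under `ev`.
  have hid : @Measurable _ _ (MeasurableSpace.comap ev MeasurableSpace.pi) MeasurableSpace.pi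
      (fun ν : ι → Measure S => ν) := by
    refine @measurable_pi_lambda _ _ _ (MeasurableSpace.comap ev MeasurableSpace.pi) _ _ fun i => ?_
    refine @Measure.measurable_of_measurable_coe _ _ _ (MeasurableSpace.comap ev _) _ fun B hB => ?_
    exact (measurable_pi_apply (i, (⟨B, hB⟩ : {B : Set S // MeasurableSet B}))).comp
      (comap_measurable ev)
  ext A hA
  obtain ⟨B, hB, hBA⟩ := hid hA
  change ev ⁻¹' B = A at hBA
  rw [← hBA, ← Measure.map_apply hev hB, ← Measure.map_apply hev hB, hmap]

end Laplace

/-! ### The generating functional of a Poisson process. -/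

section Poisson

theorem tsum_ofReal_exp_series {x : ℝ} (hx : 0 ≤ x) :
    ∑' n : ℕ, ENNReal.ofReal (x ^ n / n.factorial) = ENNReal.ofReal (Real.exp x) := by
  have h := NormedSpace.expSeries_div_hasSum_exp x
  rw [← Real.exp_eq_exp_ℝ] at h
  rw [← ENNReal.ofReal_tsum_of_nonneg (fun n => by positivity) h.summable, h.tsum_eq]

/-- The generating function `E vⁿ = exp(r (v - 1))`, with a real exponent because counts take values
in `[0, ∞]`. -/
theorem lintegral_poissonENNReal_rpow {r v : ℝ≥0∞} (hr : r ≠ ⊤) (hv : v ≠ ⊤) :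
    ∫⁻ x, v ^ x.toReal ∂poissonENNReal r =
      ENNReal.ofReal (Real.exp (v.toReal * r.toReal - r.toReal)) := by
  lift r to ℝ≥0 using hr
  lift v to ℝ≥0 using hv
  have hm : Measurable fun x : ℝ≥0∞ => (v : ℝ≥0∞) ^ x.toReal :=
    measurable_const.pow ENNReal.measurable_toReal
  rw [poissonENNReal, if_neg ENNReal.coe_ne_top, lintegral_map hm (by fun_prop), poissonMeasure,
    lintegral_sum_measure]
  simp only [lintegral_smul_measure, lintegral_dirac, ENNReal.toNNReal_coe, ENNReal.toReal_natCast,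
    ENNReal.rpow_natCast, smul_eq_mul, ENNReal.coe_toReal]
  have : ∀ n : ℕ, ENNReal.ofReal (Real.exp (-r) * r ^ n / n.factorial) * (v : ℝ≥0∞) ^ n =
      ENNReal.ofReal (Real.exp (-r)) * ENNReal.ofReal ((v * r : ℝ) ^ n / n.factorial) := by
    intro n
    rw [← ENNReal.ofReal_coe_nnreal, ← ENNReal.ofReal_pow (NNReal.coe_nonneg v), ← ENNReal.ofReal_mul (by positivity),
      ← ENNReal.ofReal_mul (by positivity)]
    congr 1
    ring
  simp_rw [this]
  rw [ENNReal.tsum_mul_left, tsum_ofReal_exp_series (by positivity),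
    ← ENNReal.ofReal_mul (by positivity), ← Real.exp_add]
  congr 2
  ring

theorem measurable_comp_nat {Ω β : Type*} [MeasurableSpace Ω] [MeasurableSpace β] {N : Ω → ℕ}
    (hN : Measurable N) {F : ℕ → Ω → β} (hF : ∀ n, Measurable (F n)) :
    Measurable fun ω => F (N ω) ω :=
  (measurable_from_prod_countable_right (f := fun z : ℕ × Ω => F z.1 z.2) hF).comp
    (hN.prodMk measurable_id)

variable {Ω S : Type*} [MeasurableSpace Ω] [MeasurableSpace S] {P : Measure Ω}
  {N : Ω → ℕ} {Z : ℕ → Ω → S} {m : Measure S}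

theorem sum_dirac_apply {ι : Type*} (s : Finset ι) (z : ι → S) {B : Set S} (hB : MeasurableSet B)
    [DecidablePred fun k => z k ∈ B] :
    (∑ k ∈ s, Measure.dirac (z k)) B = (s.filter fun k => z k ∈ B).card := by
  simp [Measure.finsetSum_apply, Measure.dirac_apply' _ hB, Set.indicator_apply]

/-- Grouping the points by the value of `h` gives `∏_v v^{η(h = v)}`; the level sets are disjoint,
so the counts are independent Poisson variables. -/
theorem IsPoissonProcess.lintegral_prod_simpleFunc [IsFiniteMeasure m]
    (hη : IsPoissonProcess P (fun ω => ∑ k ∈ Finset.range (N ω), Measure.dirac (Z k ω)) m)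
    (h : SimpleFunc S ℝ≥0∞) (htop : ∀ s, h s ≠ ⊤) :
    ∫⁻ ω, ∏ k ∈ Finset.range (N ω), h (Z k ω) ∂P =
      ENNReal.ofReal (Real.exp ((∫⁻ s, h s ∂m).toReal - m.real univ)) := by
  classical
  have hB : ∀ v, MeasurableSet (h ⁻¹' {v}) := fun v => h.measurableSet_preimage _
  have hne : ∀ v ∈ h.range, v ≠ ⊤ := by
    intro v hv
    obtain ⟨s, rfl⟩ := SimpleFunc.mem_range.1 hv
    exact htop s
  let η : Ω → Measure S := fun ω => ∑ k ∈ Finset.range (N ω), Measure.dirac (Z k ω)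
  have hφ : ∀ v : ℝ≥0∞, Measurable fun x : ℝ≥0∞ => v ^ x.toReal := fun v =>
    measurable_const.pow ENNReal.measurable_toReal
  have hmη : ∀ v, Measurable fun ω => η ω (h ⁻¹' {v}) := fun v =>
    (Measure.measurable_coe (hB v)).comp hη.measurable
  have hprod : ∀ ω, ∏ k ∈ Finset.range (N ω), h (Z k ω) =
      ∏ v ∈ h.range, v ^ (η ω (h ⁻¹' {v})).toReal := by
    intro ω
    rw [← Finset.prod_fiberwise_of_maps_to (t := h.range) (g := fun k => h (Z k ω))
      fun k _ => h.mem_range_self _]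
    refine Finset.prod_congr rfl fun v _ => ?_
    rw [sum_dirac_apply _ _ (hB v), ENNReal.toReal_natCast, ENNReal.rpow_natCast]
    refine (Finset.prod_congr rfl fun k hk => (Finset.mem_filter.1 hk).2).trans ?_
    simp only [Finset.prod_const, mem_preimage, mem_singleton_iff]
  have hind : iIndepFun (fun (v : h.range) ω => (v : ℝ≥0∞) ^ (η ω (h ⁻¹' {v.1})).toReal) P := by
    have h1 := hη.count_indep h.range.card (fun j => h ⁻¹' {(h.range.equivFin.symm j).1})
      (fun j => hB _) fun j k hjk => by
        refine Disjoint.preimage _ (disjoint_singleton.2 fun he => hjk ?_)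
        exact h.range.equivFin.symm.injective (Subtype.ext he)
    have h2 := (h1.precomp h.range.equivFin.injective).comp (fun (v : h.range) x =>
      (v : ℝ≥0∞) ^ x.toReal) fun v => hφ _
    simpa [Function.comp_def, η] using h2
  simp_rw [hprod, ← Finset.prod_coe_sort h.range]
  rw [lintegral_prod_eq_prod_lintegral_of_indepFun _ _ hind fun v => (hφ _).comp (hmη _)]
  have hone : ∀ v : h.range, ∫⁻ ω, (v : ℝ≥0∞) ^ (η ω (h ⁻¹' {v.1})).toReal ∂P =
      ENNReal.ofReal (Real.exp (v.1.toReal * (m (h ⁻¹' {v.1})).toReal -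
        (m (h ⁻¹' {v.1})).toReal)) := by
    intro v
    rw [← lintegral_poissonENNReal_rpow (measure_ne_top m _) (hne v v.2), ← hη.count_law _ (hB _),
      lintegral_map (hφ _) (hmη _)]
  simp_rw [hone]
  rw [← ENNReal.ofReal_prod_of_nonneg fun v _ => (Real.exp_pos _).le, ← Real.exp_sum,
    Finset.sum_sub_distrib]
  congr 3
  · rw [SimpleFunc.lintegral_eq_lintegral, SimpleFunc.lintegral,
      Finset.sum_coe_sort h.range fun v => v.toReal * (m (h ⁻¹' {v})).toReal,
      ENNReal.toReal_sum fun v hv => ENNReal.mul_ne_top (hne v hv) (measure_ne_top m _)]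
    simp_rw [ENNReal.toReal_mul]
  · rw [Finset.sum_coe_sort h.range fun v => (m (h ⁻¹' {v})).toReal, measureReal_def,
      ← h.sum_range_measure_preimage_singleton m,
      ENNReal.toReal_sum fun v _ => measure_ne_top m _]

/-- The probability generating functional of a Poisson point process. -/
theorem IsPoissonProcess.lintegral_prod [IsFiniteMeasure m] (hN : Measurable N)
    (hZ : ∀ k, Measurable (Z k))
    (hη : IsPoissonProcess P (fun ω => ∑ k ∈ Finset.range (N ω), Measure.dirac (Z k ω)) m)
    {h : S → ℝ≥0∞} (hh : Measurable h) (h1 : ∀ s, h s ≤ 1) :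
    ∫⁻ ω, ∏ k ∈ Finset.range (N ω), h (Z k ω) ∂P =
      ENNReal.ofReal (Real.exp ((∫⁻ s, h s ∂m).toReal - m.real univ)) := by
  have hle : ∀ n s, SimpleFunc.eapprox h n s ≤ h s := fun n s => by
    rw [← SimpleFunc.iSup_eapprox_apply hh s]
    exact le_iSup (fun n => SimpleFunc.eapprox h n s) n
  have hmono : ∀ s, Monotone fun n => SimpleFunc.eapprox h n s := fun s _ _ hij =>
    SimpleFunc.monotone_eapprox h hij s
  have htop : ∀ s, h s ≠ ⊤ := fun s => ((h1 s).trans_lt ENNReal.one_lt_top).ne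
  -- Monotone convergence along simple functions increasing to `h`; finiteness of the factors is
  -- needed for the products to converge.
  have hL := lintegral_tendsto_of_tendsto_of_monotone (μ := P)
    (f := fun n ω => ∏ k ∈ Finset.range (N ω), SimpleFunc.eapprox h n (Z k ω))
    (F := fun ω => ∏ k ∈ Finset.range (N ω), h (Z k ω))
    (fun n => (measurable_comp_nat (F := fun j ω => ∏ k ∈ Finset.range j,
      SimpleFunc.eapprox h n (Z k ω)) hN fun j => Finset.measurable_prod _ fun k _ =>
        (SimpleFunc.measurable _).comp (hZ k)).aemeasurable)
    (ae_of_all _ fun ω i j hij => Finset.prod_le_prod' fun k _ => hmono _ hij)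
    (ae_of_all _ fun ω => ENNReal.tendsto_finsetProd_of_ne_top _
      (fun k _ => SimpleFunc.tendsto_eapprox hh _) fun k _ => htop _)
  have hR := lintegral_tendsto_of_tendsto_of_monotone (μ := m)
    (f := fun n s => SimpleFunc.eapprox h n s) (F := h)
    (fun n => (SimpleFunc.measurable _).aemeasurable) (ae_of_all _ hmono)
    (ae_of_all _ fun s => SimpleFunc.tendsto_eapprox hh s)
  have hfin : ∫⁻ s, h s ∂m ≠ ⊤ :=
    ((lintegral_mono h1).trans_lt (by simp)).ne
  refine tendsto_nhds_unique hL ?_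
  simp_rw [hη.lintegral_prod_simpleFunc _ fun s =>
    ((hle _ s).trans_lt ((h1 s).trans_lt ENNReal.one_lt_top)).ne]
  exact (ENNReal.continuous_ofReal.comp Real.continuous_exp).continuousAt.tendsto.comp
    (((ENNReal.tendsto_toReal hfin).comp hR).sub_const _)

end Poisson

/-! ### Independent marks given the emissions. -/

section Marking

theorem lintegral_eq_tsum_fiber {Ω τ : Type*} [MeasurableSpace Ω] [Countable τ] {T : Ω → τ}
    (hT : ∀ t, MeasurableSet {ω | T ω = t}) (P : Measure Ω) (f : Ω → ℝ≥0∞) :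
    ∫⁻ ω, f ω ∂P = ∑' t, ∫⁻ ω in {ω | T ω = t}, f ω ∂P := by
  rw [← lintegral_iUnion hT (fun s t hst => disjoint_left.2 fun ω hs ht => hst (hs.symm.trans ht)),
    iUnion_eq_univ_iff.2 fun ω => ⟨T ω, rfl⟩, setLIntegral_univ]

variable {Ω X : Type*} [MeasurableSpace Ω] [MeasurableSpace X] {d : ℕ} {P : Measure Ω}
  {m : Measure (I × X)} {p : Fin d → X → ℝ} {N : Ω → ℕ} {Z : ℕ → Ω → I × X}
  {D : ℕ → Ω → Option (Fin d)}

theorem measurable_markProb (hp : ∀ i, Measurable (p i)) (e : Option (Fin d)) :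
    Measurable (markProb p e) := by
  cases e with
  | none => exact measurable_const.sub (Finset.measurable_sum _ fun i _ => hp i)
  | some i => exact hp i

theorem IsExperiment.measurableSet_marks (hE : IsExperiment P m p N Z D) (n : ℕ)
    (e : Fin n → Option (Fin d)) : MeasurableSet {ω | (fun k : Fin n => D k ω) = e} := by
  simp only [funext_iff, ofPred_forall]
  exact MeasurableSet.iInter fun k => hE.measurableSet_mark k (e k)

/-- The field `detection` says that two measures on position lists agree on every measurable set;
equality of measures extends this to integrands `G`. -/
theorem IsExperiment.setLIntegral_marks (hE : IsExperiment P m p N Z D)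
    (hp : ∀ i, Measurable (p i)) (n : ℕ) (e : Fin n → Option (Fin d))
    {G : (Fin n → I × X) → ℝ≥0∞} (hG : Measurable G) :
    ∫⁻ ω in {ω | (fun k : Fin n => D k ω) = e}, G (fun k => Z k ω) ∂P.restrict {ω | N ω = n} =
      ∫⁻ ω in {ω | N ω = n},
        (∏ k : Fin n, ENNReal.ofReal (markProb p (e k) (Z k ω).2)) * G (fun k => Z k ω) ∂P := by
  have hZ : Measurable fun ω => fun k : Fin n => Z k ω :=
    measurable_pi_lambda _ fun k => hE.measurable_point k
  have hq : Measurable fun ω => ∏ k : Fin n, ENNReal.ofReal (markProb p (e k) (Z k ω).2) :=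
    Finset.measurable_prod _ fun k _ => ((measurable_markProb hp (e k)).comp
      (hE.measurable_point k).snd).ennreal_ofReal
  have hN : MeasurableSet {ω | N ω = n} := hE.measurable_num (measurableSet_singleton n)
  have hlaw : ((P.restrict {ω | N ω = n}).restrict {ω | (fun k : Fin n => D k ω) = e}).map
      (fun ω => fun k : Fin n => Z k ω) = ((P.restrict {ω | N ω = n}).withDensity
        fun ω => ∏ k : Fin n, ENNReal.ofReal (markProb p (e k) (Z k ω).2)).map
      (fun ω => fun k : Fin n => Z k ω) := by
    ext E hEm
    rw [Measure.map_apply hZ hEm, Measure.map_apply hZ hEm, withDensity_apply _ (hZ hEm),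
      Measure.restrict_restrict (hZ hEm), Measure.restrict_apply (hZ hEm),
      Measure.restrict_apply ((hZ hEm).inter (hE.measurableSet_marks n e))]
    convert hE.detection n e E hEm using 2
    · ext ω
      simp only [mem_inter_iff, mem_preimage, mem_ofPred_eq, funext_iff]
      tauto
    · congr 1
      ext ω
      simp only [mem_inter_iff, mem_preimage, mem_ofPred_eq]
      tauto
  rw [← lintegral_map hG hZ, hlaw, lintegral_map hG hZ]
  exact lintegral_withDensity_eq_lintegral_mul _ hq (hG.comp hZ)

/-- Independent marking: averaging over the marks, given the points. -/
theorem IsExperiment.lintegral_prod_mark (hE : IsExperiment P m p N Z D)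
    (hp : ∀ i, Measurable (p i)) {w : Option (Fin d) → I × X → ℝ≥0∞} (hw : ∀ e, Measurable (w e)) :
    ∫⁻ ω, ∏ k ∈ Finset.range (N ω), w (D k ω) (Z k ω) ∂P =
      ∫⁻ ω, ∏ k ∈ Finset.range (N ω),
        ∑ e, ENNReal.ofReal (markProb p e (Z k ω).2) * w e (Z k ω) ∂P := by
  have hN : ∀ n, MeasurableSet {ω | N ω = n} := fun n =>
    hE.measurable_num (measurableSet_singleton n)
  have hD := hE.measurableSet_marks
  rw [lintegral_eq_tsum_fiber hN, lintegral_eq_tsum_fiber hN]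
  refine tsum_congr fun n => ?_
  have hr : ∀ f : ℕ → Ω → ℝ≥0∞, ∫⁻ ω in {ω | N ω = n}, ∏ k ∈ Finset.range (N ω), f k ω ∂P =
      ∫⁻ ω in {ω | N ω = n}, ∏ k : Fin n, f k ω ∂P := fun f =>
    setLIntegral_congr_fun (hN n) fun ω (hω : N ω = n) => by
      simp only [hω, Finset.prod_range]
  rw [hr fun k ω => w (D k ω) (Z k ω), hr fun k ω =>
    ∑ e, ENNReal.ofReal (markProb p e (Z k ω).2) * w e (Z k ω), lintegral_eq_tsum_fiber (hD n),
    tsum_fintype]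
  have hGm : ∀ e : Fin n → Option (Fin d),
      Measurable fun z : Fin n → I × X => ∏ k, w (e k) (z k) := fun e =>
    Finset.measurable_prod _ fun k _ => (hw (e k)).comp (measurable_pi_apply k)
  have h1 : ∀ e : Fin n → Option (Fin d),
      ∫⁻ ω in {ω | (fun k : Fin n => D k ω) = e}, ∏ k : Fin n, w (D k ω) (Z k ω)
        ∂P.restrict {ω | N ω = n} =
      ∫⁻ ω in {ω | N ω = n},
        ∏ k : Fin n, ENNReal.ofReal (markProb p (e k) (Z k ω).2) * w (e k) (Z k ω) ∂P := by
    intro e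
    simp_rw [Finset.prod_mul_distrib]
    rw [← hE.setLIntegral_marks hp n e (hGm e)]
    exact setLIntegral_congr_fun (hD n e) fun ω hω =>
      Finset.prod_congr rfl fun k _ => by rw [← congr_fun (show _ = e from hω) k]
  simp_rw [h1]
  have h2 : ∀ e : Fin n → Option (Fin d), Measurable fun ω =>
      ∏ k : Fin n, ENNReal.ofReal (markProb p (e k) (Z k ω).2) * w (e k) (Z k ω) := fun e =>
    Finset.measurable_prod _ fun k _ =>
      (((measurable_markProb hp (e k)).comp (hE.measurable_point k).snd).ennreal_ofReal).mul
        ((hw (e k)).comp (hE.measurable_point k))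
  rw [← lintegral_finsetSum _ fun e _ => h2 e]
  refine lintegral_congr fun ω => ?_
  -- Summing a product over all mark vectors is the product of the sums over single marks.
  rw [Finset.prod_univ_sum, Fintype.piFinset_univ]

end Marking

/-! ### Laplace functional of the observed point measures. -/

section Observation

variable {Ω X : Type*} {d : ℕ} {N : Ω → ℕ} {Z : ℕ → Ω → I × X} {D : ℕ → Ω → Option (Fin d)}

theorem IsExperiment.measurable_observation [MeasurableSpace Ω] [MeasurableSpace X] {P : Measure Ω}
    {m : Measure (I × X)} {p : Fin d → X → ℝ} (hE : IsExperiment P m p N Z D) :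
    Measurable (observation N Z D) := by
  classical
  refine measurable_pi_lambda _ fun i => ?_
  refine measurable_comp_nat (F := fun n ω => ∑ k ∈ (Finset.range n).filter
    (fun k => D k ω = some i), Measure.dirac (Z k ω).1) hE.measurable_num fun n => ?_
  refine Measure.measurable_of_measurable_coe _ fun B hB => ?_
  simp only [Finset.sum_filter, Measure.finsetSum_apply]
  refine Finset.measurable_sum _ fun k _ => ?_
  have : ∀ ω, (if D k ω = some i then Measure.dirac (Z k ω).1 else 0) B =
      {ω | D k ω = some i}.indicator (fun ω => Measure.dirac (Z k ω).1 B) ω := fun ω => by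
    by_cases h : D k ω = some i <;> simp [h]
  simp_rw [this]
  exact ((Measure.measurable_coe hB).comp (Measure.measurable_dirac.comp
    (hE.measurable_point k).fst)).indicator (hE.measurableSet_mark k _)

/-- The weight `exp (-u i t)` of a detection in detector `i` at the time `t`, and `1` if nothing is
detected. -/
noncomputable def markWeight (u : Fin d → I → ℝ≥0∞) : Option (Fin d) → I × X → ℝ≥0∞
  | some i => fun z => expNeg (u i z.1)
  | none => 1

theorem measurable_markWeight [MeasurableSpace X] {u : Fin d → I → ℝ≥0∞} (hu : ∀ i, Measurable (u i))
    (e : Option (Fin d)) : Measurable (markWeight (X := X) u e) := by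
  cases e with
  | none => exact measurable_one
  | some i => exact measurable_expNeg.comp ((hu i).comp measurable_fst)

/-- Each emission is seen by at most one detector, so exchanging the products over detectors and
emissions leaves one weight per emission. -/
theorem prod_expNeg_lintegral_observation {u : Fin d → I → ℝ≥0∞} (hu : ∀ i, Measurable (u i))
    (ω : Ω) : ∏ i, expNeg (∫⁻ t, u i t ∂observation N Z D ω i) =
      ∏ k ∈ Finset.range (N ω), markWeight u (D k ω) (Z k ω) := by
  classical
  have : ∀ i, expNeg (∫⁻ t, u i t ∂observation N Z D ω i) =
      ∏ k ∈ Finset.range (N ω), if D k ω = some i then expNeg (u i (Z k ω).1) else 1 := by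
    intro i
    rw [observation, lintegral_finsetSum_measure, expNeg_sum, ← Finset.prod_filter]
    refine Finset.prod_congr (by congr) fun k _ => ?_
    rw [lintegral_dirac' _ (hu i)]
  simp_rw [this]
  rw [Finset.prod_comm]
  refine Finset.prod_congr rfl fun k _ => ?_
  cases h : D k ω with
  | none => simp [markWeight]
  | some j => simp [markWeight]

end Observation

/-! ### Exponential formula for the reference measure. -/

section Reference

theorem lintegral_prod_pi {E : Type*} [MeasurableSpace E] {n : ℕ} (μ : Fin n → Measure E)
    [∀ i, SigmaFinite (μ i)] {f : Fin n → E → ℝ≥0∞} (hf : ∀ i, Measurable (f i)) :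
    ∫⁻ x, ∏ i, f i (x i) ∂Measure.pi μ = ∏ i, ∫⁻ x, f i x ∂μ i := by
  induction n with
  | zero => simp
  | succ n ih =>
    have hg : Measurable fun y : Fin n → E => ∏ i, f i.succ (y i) :=
      Finset.measurable_prod _ fun i _ => (hf i.succ).comp (measurable_pi_apply i)
    have hG : Measurable fun z : E × (Fin n → E) => f 0 z.1 * ∏ i, f i.succ (z.2 i) :=
      ((hf 0).comp measurable_fst).mul (hg.comp measurable_snd)
    rw [Fin.prod_univ_succ, ← ih (fun i => μ i.succ) fun i => hf i.succ,
      ← lintegral_prod_mul (hf 0).aemeasurable hg.aemeasurable]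
    refine Eq.trans ?_ ((measurePreserving_piFinSuccAbove μ 0).lintegral_comp hG)
    refine lintegral_congr fun x => ?_
    rw [Fin.prod_univ_succ]
    rfl

/-- Lists of length `n` contribute `(∫ f)ⁿ / n!`, the terms of the exponential series. -/
theorem lintegral_refList {f : I → ℝ≥0∞} (hf : Measurable f) (hfin : ∫⁻ t, f t ≠ ⊤) :
    ∫⁻ z, ∏ j, f (z.2 j) ∂refList = ENNReal.ofReal (Real.exp (∫⁻ t, f t).toReal) := by
  have hm : Measurable fun z : (n : ℕ) × (Fin n → I) => ∏ j, f (z.2 j) :=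
    measurable_sigma_iff.2 fun n =>
      Finset.measurable_prod Finset.univ fun j _ => hf.comp (measurable_pi_apply j)
  rw [refList, lintegral_sum_measure, ← tsum_ofReal_exp_series ENNReal.toReal_nonneg]
  refine tsum_congr fun n => ?_
  have hs : Measurable fun s : Fin n → I => (⟨n, s⟩ : (n : ℕ) × (Fin n → I)) :=
    measurable_sigma_iff.1 measurable_id n
  rw [lintegral_smul_measure, lintegral_map hm hs,
    volume_pi, lintegral_prod_pi _ fun _ => hf, Finset.prod_const, Finset.card_fin, div_eq_inv_mul,
    ENNReal.ofReal_mul (by positivity), ENNReal.ofReal_pow ENNReal.toReal_nonneg,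
    ENNReal.ofReal_toReal hfin, ENNReal.ofReal_inv_of_pos (by positivity), ENNReal.ofReal_natCast,
    smul_eq_mul]

instance : IsFiniteMeasure refList := by
  have h := lintegral_refList (f := 1) measurable_one (by simp)
  simp only [Pi.one_apply, Finset.prod_const_one, lintegral_one] at h
  exact ⟨h ▸ ENNReal.ofReal_lt_top⟩

theorem lintegral_refData {d : ℕ} {f : Fin d → I → ℝ≥0∞} (hf : ∀ i, Measurable (f i))
    (hfin : ∀ i, ∫⁻ t, f i t ≠ ⊤) (C : Fin d → ℝ≥0∞) :
    ∫⁻ y, ∏ i, (C i * ∏ j, f i ((y i).2 j)) ∂refData d =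
      ∏ i, C i * ENNReal.ofReal (Real.exp (∫⁻ t, f i t).toReal) := by
  have hm : ∀ i, Measurable fun z : (n : ℕ) × (Fin n → I) => ∏ j, f i (z.2 j) := fun i =>
    measurable_sigma_iff.2 fun n =>
      Finset.measurable_prod Finset.univ fun j _ => (hf i).comp (measurable_pi_apply j)
  refine (lintegral_prod_pi (fun _ : Fin d => refList) fun i => (hm i).const_mul (C i)).trans ?_
  exact Finset.prod_congr rfl fun i _ => by
    rw [lintegral_const_mul _ (hm i), lintegral_refList (hf i) (hfin i)]

theorem measurable_toPoints {d : ℕ} : Measurable (Data.toPoints (d := d)) := by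
  have h : Measurable fun z : (n : ℕ) × (Fin n → I) => ∑ j, Measure.dirac (z.2 j) := by
    refine measurable_sigma_iff.2 fun n => Measure.measurable_of_measurable_coe _ fun B hB => ?_
    simp only [Measure.finsetSum_apply]
    exact Finset.measurable_sum Finset.univ fun j _ => (Measure.measurable_coe hB).comp
      (Measure.measurable_dirac.comp (measurable_pi_apply j))
  exact measurable_pi_lambda _ fun i =>
    h.comp (measurable_pi_apply (X := fun _ : Fin d => (n : ℕ) × (Fin n → I)) i)

theorem expNeg_lintegral_toPoints {d : ℕ} {u : Fin d → I → ℝ≥0∞} (hu : ∀ i, Measurable (u i))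
    (y : Data d) (i : Fin d) :
    expNeg (∫⁻ t, u i t ∂y.toPoints i) = ∏ j, expNeg (u i ((y i).2 j)) := by
  rw [Data.toPoints, lintegral_finsetSum_measure, expNeg_sum]
  simp_rw [lintegral_dirac' _ (hu i)]

end Reference

/-! ### Comparison of the two Laplace functionals. -/

section Law

theorem sum_ofReal_markProb {X : Type*} {d : ℕ} {p : Fin d → X → ℝ} {x : X} (h0 : ∀ i, 0 ≤ p i x)
    (h1 : ∑ i, p i x ≤ 1) : ∑ e, ENNReal.ofReal (markProb p e x) = 1 := by
  rw [← ENNReal.ofReal_sum_of_nonneg, Fintype.sum_option]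
  · simp [markProb]
  · rintro (_ | i) -
    · exact sub_nonneg.2 h1
    · exact h0 i

variable {X : Type*} [TopologicalSpace X] [CompactSpace X] [T2Space X] {d : ℕ}
  {a : Fin d → C(X, ℝ)} {W : I → Radon X →L[ℝ] Radon X}

theorem lintegral_likelihood_mul_prod_expNeg [SecondCountableTopology X] (ha : ∀ i, 0 ≤ a i)
    (hW : PreservesNonneg W)
    (hmeas : ∀ (μ : PosRadon X) (g : C(X, ℝ)), Measurable fun t : I => W t μ.1 g)
    (hint : ∫⁻ t : I, ‖adjoint (W t) 1‖ₑ < ⊤) (μ : PosRadon X)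
    {u : Fin d → I → ℝ≥0∞} (hu : ∀ i, Measurable (u i)) :
    ∫⁻ ν, ∏ i, expNeg (∫⁻ t, u i t ∂ν i)
        ∂((refData d).withDensity (likelihood a W μ)).map Data.toPoints =
      ENNReal.ofReal (Real.exp
        ((∑ i, ∫⁻ t, expNeg (u i t) * ENNReal.ofReal (detIntensity a W μ i t)).toReal -
          (∑ i, ∫⁻ t, ENNReal.ofReal (detIntensity a W μ i t)).toReal)) := by
  have hβ : ∀ i, Measurable fun t => ENNReal.ofReal (detIntensity a W μ i t) := fun i =>
    (measurable_detIntensity a hmeas μ i).ennreal_ofReal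
  have hβi := integrable_detIntensity a hW hmeas hint μ
  have hβfin : ∀ i, ∫⁻ t, ENNReal.ofReal (detIntensity a W μ i t) ≠ ⊤ := fun i =>
    (hβi i).lintegral_lt_top.ne
  have hfm : ∀ i, Measurable fun t => expNeg (u i t) * ENNReal.ofReal (detIntensity a W μ i t) :=
    fun i => (measurable_expNeg.comp (hu i)).mul (hβ i)
  have hfin : ∀ i, ∫⁻ t, expNeg (u i t) * ENNReal.ofReal (detIntensity a W μ i t) ≠ ⊤ := fun i =>
    ne_top_of_le_ne_top (hβfin i) <| lintegral_mono fun t => mul_le_of_le_one_left' (expNeg_le_one _)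
  have hmL : Measurable fun ν : Fin d → Measure I => ∏ i, expNeg (∫⁻ t, u i t ∂ν i) :=
    Finset.measurable_prod _ fun i _ => measurable_expNeg.comp <|
      (Measure.measurable_lintegral (hu i)).comp
        (measurable_pi_apply (X := fun _ : Fin d => Measure I) i)
  rw [lintegral_map hmL measurable_toPoints]
  refine (lintegral_withDensity_eq_lintegral_mul _
    (measurable_likelihood a hmeas μ) (hmL.comp measurable_toPoints)).trans ?_
  have h : ∀ y : Data d, (likelihood a W μ * (fun ν : Fin d → Measure I =>
      ∏ i, expNeg (∫⁻ t, u i t ∂ν i)) ∘ Data.toPoints) y =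
      ∏ i, (ENNReal.ofReal (Real.exp (-∫ t : I, detIntensity a W μ i t)) *
        ∏ j, expNeg (u i ((y i).2 j)) *
          ENNReal.ofReal (detIntensity a W μ i ((y i).2 j))) := by
    intro y
    have h0 := detIntensity_nonneg ha hW μ
    simp only [Pi.mul_apply, Function.comp_apply, expNeg_lintegral_toPoints hu, likelihood]
    rw [ENNReal.ofReal_prod_of_nonneg fun i _ => mul_nonneg (Real.exp_pos _).le
      (Finset.prod_nonneg fun j _ => h0 i _), ← Finset.prod_mul_distrib]
    refine Finset.prod_congr rfl fun i _ => ?_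
    rw [ENNReal.ofReal_mul (Real.exp_pos _).le, ENNReal.ofReal_prod_of_nonneg fun j _ => h0 i _,
      Finset.prod_mul_distrib]
    ring
  rw [lintegral_congr h, lintegral_refData hfm hfin]
  have h2 : ∀ i, ENNReal.ofReal (Real.exp (-∫ t : I, detIntensity a W μ i t)) *
      ENNReal.ofReal (Real.exp
        (∫⁻ t, expNeg (u i t) * ENNReal.ofReal (detIntensity a W μ i t)).toReal) =
      ENNReal.ofReal (Real.exp
        ((∫⁻ t, expNeg (u i t) * ENNReal.ofReal (detIntensity a W μ i t)).toReal -
          (∫⁻ t, ENNReal.ofReal (detIntensity a W μ i t)).toReal)) := by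
    intro i
    rw [← ENNReal.ofReal_mul (Real.exp_pos _).le, ← Real.exp_add,
      integral_eq_lintegral_of_nonneg_ae (ae_of_all _ (detIntensity_nonneg ha hW μ i))
        (hβi i).aestronglyMeasurable]
    congr 2
    ring
  simp_rw [h2]
  rw [← ENNReal.ofReal_prod_of_nonneg fun i _ => (Real.exp_pos _).le, ← Real.exp_sum,
    Finset.sum_sub_distrib, ENNReal.toReal_sum fun i _ => hfin i,
    ENNReal.toReal_sum fun i _ => hβfin i]

variable [MeasurableSpace X] [BorelSpace X] [HasOuterApproxClosed X] {hW : PreservesNonneg W}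

/-- The `c` of the intensity cancels the denominator of `aᵢ / c`. The undetected part does not
involve `u` and is kept apart, to cancel against the same term in the total mass. -/
theorem lintegral_sum_markProb_mul_markWeight (ha : ∀ i, 0 ≤ a i)
    (hmeas : ∀ (μ : PosRadon X) (g : C(X, ℝ)), Measurable fun t : I => W t μ.1 g)
    (μ : PosRadon X) {c : ℝ≥0} (hc : 0 < c) {u : Fin d → I → ℝ≥0∞} (hu : ∀ i, Measurable (u i)) :
    ∫⁻ z, ∑ e, ENNReal.ofReal (markProb (fun i x => a i x / c) e z.2) * markWeight u e z
        ∂(c • timeSpaceMeasure W hW μ) =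
      ∫⁻ z, ENNReal.ofReal (markProb (fun i x => a i x / c) none z.2)
        ∂(c • timeSpaceMeasure W hW μ) +
      ∑ i, ∫⁻ t, expNeg (u i t) * ENNReal.ofReal (detIntensity a W μ i t) := by
  have hp : ∀ e, Measurable fun z : I × X =>
      ENNReal.ofReal (markProb (fun i x => a i x / c) e z.2) := fun e =>
    ((measurable_markProb (fun i => (a i).continuous.measurable.div_const _) e).comp
      measurable_snd).ennreal_ofReal
  have hpw : ∀ e, Measurable fun z : I × X =>
      ENNReal.ofReal (markProb (fun i x => a i x / c) e z.2) * markWeight u e z := fun e =>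
    (hp e).mul (measurable_markWeight hu e)
  rw [lintegral_finsetSum _ fun e _ => hpw e, Fintype.sum_option]
  congr 1
  · simp [markWeight]
  · refine Finset.sum_congr rfl fun i _ => ?_
    have h : ∀ z : I × X, ENNReal.ofReal (markProb (fun i x => a i x / c) (some i) z.2) *
        markWeight u (some i) z =
        (c : ℝ≥0∞)⁻¹ * (expNeg (u i z.1) * ENNReal.ofReal (a i z.2)) := by
      intro z
      rw [markProb, markWeight, ENNReal.ofReal_div_of_pos (NNReal.coe_pos.2 hc),
        ENNReal.ofReal_coe_nnreal, ENNReal.div_eq_inv_mul]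
      ring
    have hm : Measurable fun z : I × X => expNeg (u i z.1) * ENNReal.ofReal (a i z.2) :=
      (measurable_expNeg.comp ((hu i).comp measurable_fst)).mul
        ((a i).continuous.measurable.comp measurable_snd).ennreal_ofReal
    simp_rw [h]
    rw [lintegral_const_mul _ hm, lintegral_smul_measure,
      lintegral_timeSpaceMeasure_mul hW hmeas μ (v := fun t => expNeg (u i t))
        (measurable_expNeg.comp (hu i)) (ha i),
      ENNReal.smul_def, smul_eq_mul, ← mul_assoc,
      ENNReal.inv_mul_cancel (ENNReal.coe_ne_zero.2 hc.ne') ENNReal.coe_ne_top, one_mul]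
    rfl

/-- The likelihood is the density of the law of the data. -/
theorem IsExperiment.map_observation [SecondCountableTopology X] (ha : ∀ i, 0 ≤ a i)
    (hmeas : ∀ (μ : PosRadon X) (g : C(X, ℝ)), Measurable fun t : I => W t μ.1 g)
    (hint : ∫⁻ t : I, ‖adjoint (W t) 1‖ₑ < ⊤) {μ : PosRadon X} {c : ℝ≥0} (hc : 0 < c)
    (hac : ∀ x, ∑ i, a i x ≤ c) {Ω : Type*} [MeasurableSpace Ω] {P : Measure Ω}
    [IsProbabilityMeasure P] {N : Ω → ℕ} {Z : ℕ → Ω → I × X} {D : ℕ → Ω → Option (Fin d)}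
    (hE : IsExperiment P (c • timeSpaceMeasure W hW μ) (fun i x => a i x / c) N Z D) :
    P.map (observation N Z D) =
      ((refData d).withDensity (likelihood a W μ)).map Data.toPoints := by
  have := isFiniteMeasure_timeSpaceMeasure hW hmeas hint μ
  have hp : ∀ i, Measurable fun x => a i x / c := fun i =>
    (a i).continuous.measurable.div_const _
  have hsum : ∀ x, ∑ e, ENNReal.ofReal (markProb (fun i x => a i x / c) e x) = 1 := fun x =>
    sum_ofReal_markProb (fun i => div_nonneg (ha i x) c.2) <| by
      rw [← Finset.sum_div]
      exact div_le_one_of_le₀ (hac x) c.2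
  have hw1 : ∀ (u : Fin d → I → ℝ≥0∞) e (z : I × X), markWeight u e z ≤ 1 := fun u e z => by
    cases e with
    | none => exact le_rfl
    | some i => exact expNeg_le_one _
  have hfinβ : ∀ u : Fin d → I → ℝ≥0∞,
      ∑ i, ∫⁻ t, expNeg (u i t) * ENNReal.ofReal (detIntensity a W μ i t) ≠ ⊤ := fun u =>
    ENNReal.sum_ne_top.2 fun i _ =>
      ne_top_of_le_ne_top (integrable_detIntensity a hW hmeas hint μ i).lintegral_lt_top.ne <|
        lintegral_mono fun t => mul_le_of_le_one_left' (expNeg_le_one _)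
  have hR : ∫⁻ z, ENNReal.ofReal (markProb (fun i x => a i x / c) none z.2)
      ∂(c • timeSpaceMeasure W hW μ) ≠ ⊤ := by
    refine ne_top_of_le_ne_top (measure_ne_top (c • timeSpaceMeasure W hW μ) univ) ?_
    rw [← lintegral_one]
    refine lintegral_mono fun z => ?_
    rw [← hsum z.2]
    exact Finset.single_le_sum_of_canonicallyOrdered
      (f := fun e => ENNReal.ofReal (markProb (fun i x => a i x / c) e z.2)) (Finset.mem_univ none)
  have hlaplace : ∀ u : Fin d → I → ℝ≥0∞, (∀ i, Measurable (u i)) →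
      ∫⁻ ν, ∏ i, expNeg (∫⁻ t, u i t ∂ν i) ∂P.map (observation N Z D) =
      ∫⁻ ν, ∏ i, expNeg (∫⁻ t, u i t ∂ν i)
        ∂((refData d).withDensity (likelihood a W μ)).map Data.toPoints := by
    intro u hu
    have hmL : Measurable fun ν : Fin d → Measure I => ∏ i, expNeg (∫⁻ t, u i t ∂ν i) :=
      Finset.measurable_prod _ fun i _ => measurable_expNeg.comp <|
        (Measure.measurable_lintegral (hu i)).comp
          (measurable_pi_apply (X := fun _ : Fin d => Measure I) i)
    -- At `u = 0` all weights are `1` and the mark probabilities sum to `1`, so the thinning formula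
    -- becomes a decomposition of the total mass.
    have huniv : (c • timeSpaceMeasure W hW μ) univ =
        ∫⁻ z, ENNReal.ofReal (markProb (fun i x => a i x / c) none z.2)
          ∂(c • timeSpaceMeasure W hW μ) +
        ∑ i, ∫⁻ t, ENNReal.ofReal (detIntensity a W μ i t) := by
      have h := lintegral_sum_markProb_mul_markWeight (hW := hW) ha hmeas μ hc (u := 0)
        fun _ => measurable_zero
      have hw : ∀ e (z : I × X), markWeight (0 : Fin d → I → ℝ≥0∞) e z = 1 := fun e z => by
        cases e with
        | none => rfl
        | some i => exact expNeg_zero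
      simpa only [hw, mul_one, hsum, lintegral_one, Pi.zero_apply, expNeg_zero, one_mul] using h
    rw [lintegral_likelihood_mul_prod_expNeg ha hW hmeas hint μ hu,
      lintegral_map hmL hE.measurable_observation]
    simp_rw [prod_expNeg_lintegral_observation hu]
    rw [hE.lintegral_prod_mark hp (measurable_markWeight hu),
      hE.emission.lintegral_prod hE.measurable_num hE.measurable_point
        (h := fun z => ∑ e, ENNReal.ofReal (markProb (fun i x => a i x / c) e z.2) *
          markWeight u e z) (Finset.measurable_sum _ fun e _ =>
            ((measurable_markProb hp e).comp measurable_snd).ennreal_ofReal.mul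
              (measurable_markWeight hu e))
        fun z => (Finset.sum_le_sum fun e _ =>
          mul_le_of_le_one_right' (hw1 u e z)).trans_eq (hsum z.2),
      lintegral_sum_markProb_mul_markWeight ha hmeas μ hc hu, measureReal_def, huniv,
      ENNReal.toReal_add hR (hfinβ u), ENNReal.toReal_add hR
        (by simpa [expNeg_zero] using hfinβ 0), add_sub_add_left_eq_sub]
  -- At `u = 0` the Laplace functional is the total mass.
  have hfinQ : IsFiniteMeasure
      (((refData d).withDensity (likelihood a W μ)).map Data.toPoints) := by
    have h := lintegral_likelihood_mul_prod_expNeg ha hW hmeas hint μ (u := 0)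
      fun _ => measurable_zero
    simp only [Pi.zero_apply, lintegral_zero, expNeg_zero, Finset.prod_const_one, lintegral_one]
      at h
    exact ⟨h ▸ ENNReal.ofReal_lt_top⟩
  have : IsProbabilityMeasure (P.map (observation N Z D)) :=
    Measure.isProbabilityMeasure_map hE.measurable_observation.aemeasurable
  exact ext_of_laplaceFunctional hlaplace

end Law

end ListModePET


theorem mainTheorem2 (p d : ℕ) (K : TopologicalSpace.Compacts (EuclideanSpace ℝ (Fin p)))
    (a : Fin d → C(K, ℝ)) (ha : ∀ i, 0 ≤ a i)
    (W : I → Radon K →L[ℝ] Radon K)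
    (hW : PreservesNonneg W)
    (hmeas : ∀ (μ : PosRadon K) (g : C(K, ℝ)), Measurable fun t : I => W t μ.1 g)
    (hint : ∫⁻ t : I, ‖adjoint (W t) 1‖ₑ < ⊤) :
    Integrable (fun t : I => adjoint (W t) (petAdjoint a fun _ => 1)) ∧
    (∀ (μ : PosRadon K) (i : Fin d), Integrable (detIntensity a W μ i)) ∧
    (∀ μ : PosRadon K, Measurable (likelihood a W μ) ∧
      ∀ c : ℝ≥0, 0 < c → (∀ x, ∑ i, a i x ≤ c) →
      ∀ (Ω : Type*) [MeasurableSpace Ω] (P : Measure Ω) [IsProbabilityMeasure P]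
        (N : Ω → ℕ) (Z : ℕ → Ω → I × K) (D : ℕ → Ω → Option (Fin d)),
        IsExperiment P (c • timeSpaceMeasure W hW μ) (fun i x => a i x / c) N Z D →
        P.map (observation N Z D) =
          ((refData d).withDensity (likelihood a W μ)).map Data.toPoints) ∧
    (∀ (y : Data d) (μ : PosRadon K), -(likelihood a W μ y).log = loss a W y μ) ∧
    (∀ (y : Data d) (μ : PosRadon K),
      IsMaxOn (fun ν : PosRadon K => likelihood a W ν y) univ μ ↔
        IsMinOn (loss a W y) univ μ) := by
  refine ⟨integrable_adjoint hW hmeas hint _, integrable_detIntensity a hW hmeas hint,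
    fun μ => ⟨measurable_likelihood a hmeas μ, fun c hc hac Ω _ P _ N Z D hE =>
      hE.map_observation ha hmeas hint hc hac⟩, neg_log_likelihood ha hW hmeas hint, fun y μ => ?_⟩
  simp only [isMaxOn_iff, isMinOn_iff, ← neg_log_likelihood ha hW hmeas hint y,
    EReal.neg_le_neg_iff, ENNReal.log_le_log_iff]
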